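/- Let $(x,s,y)\in\mathbb R^p\times\mathbb R\times\mathbb R$ be a random individual with law $D$, where $\|x\|=1$ and $y\in\{-1,1\}$ almost surely and $s$ is integrable. For a linear model $f\in\mathbb R^p$ (acting by $x\mapsto\langle f,x\rangle$) let $er(f)=\Pr_D\{\operatorname{sign}\langle f,x\rangle\ne y\}$ be its expected classification error and let $\hat{er}(f)$ be the fraction of the training points it misclassifies. Let $h_*\in\mathbb R^p$ satisfy $\operatorname{cov}(\langle h_*,x\rangle,s)=0$. Consider a run of the following algorithm with the soft threshold policy: a training set $(x_i,s_i,y_i)_{i=1,\dots,n}$ is drawn i.i.d. from $D$; a data center generates $m$ random linear hypotheses $h_1,\dots,h_m\in\mathbb R^p$; a third party returns a set of indices $r_1,\dots,r_k$ in such a way that, given the set of returned indices, the returned hypotheses $h_{r_1},\dots,h_{r_k}$ are independent with law $\mathcal N(h_*,I)$; the data center then trains a model $f=\alpha_1h_{r_1}+\dots+\alpha_kh_{r_k}$. (The law of the candidates $h_1,\dots,h_m$ before selection, e.g. i.i.d. $\mathcal N(0,\sigma^2I)$, is otherwise arbitrary.) Then for every $\delta>0$, with probability at least $1-4\delta$ over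 the run, if the number $k$ of returned hypotheses satisfies $k+1\le n$, then simultaneously for every linear $f$ with $\|f\|=1$ (in particular for the trained model, when it has norm $1$), $$er(f)\;\le\;\hat{er}(f)+T+\frac{4}{n\delta}\sum_{i=1}^n g(x_i)\,\exp\!\Big(-\frac{k\langle f,x_i\rangle^2}{8(2+|\langle f,x_i\rangle|)^2}\Big),$$ where $$T=2\sqrt{\frac{(k+1)\log\frac{en}{k+1}+\log\frac1\delta}{n}},\qquad g(x_i)=\exp\!\Big(\frac{c_ik\langle h_*,x_i\rangle^2}{4-2c_i}\Big)+\exp\!\Big(-\frac{c_ik\langle h_*,x_i\rangle^2}{2+2c_i}\Big),\qquad c_i=\frac{|\langle f,x_i\rangle|}{2+|\langle f,x_i\rangle|}.$$ -/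

import Mathlib

open MeasureTheory ProbabilityTheory

/-- A random individual `(x, s, y)`: `x ∈ ℝᵖ` are the non-sensitive features, `s ∈ ℝ` is the
sensitive demographic feature and `y ∈ ℝ` is the label. A linear hypothesis `x ↦ ⟨f, x⟩` is
identified with its coefficient vector `f : EuclideanSpace ℝ (Fin p)`. -/
abbrev Individual (p : ℕ) : Type := EuclideanSpace ℝ (Fin p) × ℝ × ℝ

/-- The individuals misclassified by the linear classifier `x ↦ sign ⟨f, x⟩`. -/
def misclassified {p : ℕ} (f : EuclideanSpace ℝ (Fin p)) : Set (Individual p) :=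
  {z | Real.sign (inner ℝ f z.1) ≠ z.2.2}

/-- Expected (classification) error of `f` under the law `D` of a random individual. -/
noncomputable def expectedError {p : ℕ} (D : Measure (Individual p))
    (f : EuclideanSpace ℝ (Fin p)) : ℝ :=
  D.real (misclassified f)

/-- Empirical (classification) error of `f` on the training set `S`: the fraction of
misclassified training individuals. -/
noncomputable def empiricalError {p n : ℕ} (S : Fin n → Individual p)
    (f : EuclideanSpace ℝ (Fin p)) : ℝ :=
  (∑ i, (misclassified f).indicator (fun _ => (1 : ℝ)) (S i)) / n

/-- A run of the distributed fair learning algorithm with the soft threshold policy around `hstar`.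

* `Z` is the training set, an i.i.d. sample `(xᵢ, sᵢ, yᵢ)` from `D`;
* `h` are the `m` random linear hypotheses generated by the data center;
* `R ω` is the set of indices that the third party returns to the data center, so the number of
  returned hypotheses is `(R ω).card`;
* `hstar` is a hypothesis with `cov(hstar(x), s) = 0`;
* soft threshold policy: whatever set `A` of indices is returned, the returned hypotheses
  `h t`, `t ∈ A`, are independent Gaussian vectors `N(hstar, I)`.

The joint law of all candidates before the selection (for instance i.i.d. `N(0, σ² I)`), and the
dependence between the selection and the training set, are left arbitrary. -/
structure IsSoftThresholdRun {p n m : ℕ} {Ω : Type*} [MeasurableSpace Ω] (P : Measure Ω)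
    (D : Measure (Individual p)) (hstar : EuclideanSpace ℝ (Fin p))
    (Z : Fin n → Ω → Individual p) (h : Fin m → Ω → EuclideanSpace ℝ (Fin p))
    (R : Ω → Finset (Fin m)) : Prop where
  sample_law : ∀ i, HasLaw (Z i) D P
  sample_indep : iIndepFun Z P
  measurable_returned : ∀ A, MeasurableSet {ω | R ω = A}
  integrable_sensitive : Integrable (fun z : Individual p => z.2.1) D
  cov_eq_zero :
    covariance (fun z : Individual p => inner ℝ hstar z.1) (fun z : Individual p => z.2.1) D = 0
  returned_law : ∀ A, P {ω | R ω = A} ≠ 0 → ∀ t ∈ A,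
    HasLaw (h t) (multivariateGaussian hstar (1 : Matrix (Fin p) (Fin p) ℝ))
      (ProbabilityTheory.cond P {ω | R ω = A})
  returned_indep : ∀ A, P {ω | R ω = A} ≠ 0 →
    iIndepFun (fun t : A => h t) (ProbabilityTheory.cond P {ω | R ω = A})

/-- The distortion level `c = |⟨f, x⟩| / (2 + |⟨f, x⟩|)`. -/
noncomputable def distortionLevel {p : ℕ} (f x : EuclideanSpace ℝ (Fin p)) : ℝ :=
  |inner ℝ f x| / (2 + |inner ℝ f x|)

/-- The distortion factor
`g(x) = exp (c k ⟨h, x⟩² / (4 - 2c)) + exp (- c k ⟨h, x⟩² / (2 + 2c))` of `k` Gaussian projection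
vectors `N(h, I)` at distortion level `c`. -/
noncomputable def distortionFactor {p : ℕ} (k : ℕ) (hstar : EuclideanSpace ℝ (Fin p)) (c : ℝ)
    (x : EuclideanSpace ℝ (Fin p)) : ℝ :=
  Real.exp (c * k * (inner ℝ hstar x) ^ 2 / (4 - 2 * c)) +
    Real.exp (-(c * k * (inner ℝ hstar x) ^ 2 / (2 + 2 * c)))

/-- The VC term `T = 2 √([(k + 1) log (e n / (k + 1)) + log (1 / δ)] / n)`. -/
noncomputable def vcTerm (n k : ℕ) (δ : ℝ) : ℝ :=
  2 * Real.sqrt (((k + 1) * Real.log (Real.exp 1 * n / (k + 1)) + Real.log (1 / δ)) / n)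

/-- The projection term
`(4 / (n δ)) ∑ᵢ g(xᵢ) exp (- k ⟨f, xᵢ⟩² / (8 (2 + |⟨f, xᵢ⟩|)²))`, where `g(xᵢ)` is taken at the
distortion level `cᵢ = |⟨f, xᵢ⟩| / (2 + |⟨f, xᵢ⟩|)`. -/
noncomputable def projectionTerm {p n : ℕ} (k : ℕ) (δ : ℝ) (hstar : EuclideanSpace ℝ (Fin p))
    (S : Fin n → Individual p) (f : EuclideanSpace ℝ (Fin p)) : ℝ :=
  4 / (n * δ) * ∑ i, distortionFactor k hstar (distortionLevel f (S i).1) (S i).1 *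
    Real.exp (-(k * (inner ℝ f (S i).1) ^ 2 / (8 * (2 + |inner ℝ f (S i).1|) ^ 2)))

/-! The bound is a PAC-Bayes margin bound in which the projection term pays for the points of small
margin. Fix `k` and let `β` be the margin level. Replace the classifier `f` by the random vector `w
• f + g` with `g` standard Gaussian, and count an error when its margin is below `β`. On unit
vectors the noise moves a score by `β` in a given direction with probability at most `q = exp (-β ^
2 / 2)`. Hence the smoothed loss is at least `1 - q` at a misclassified point, and at most `q` at a
point where `w • f` has margin at least `2 * β`.

The distortion factor is at least 1, so the summand `(4 / δ) * g(xᵢ) * exp (...)` is below 1 only if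
`k * ⟨f, xᵢ⟩ ^ 2` exceeds `8 * log (4 / δ) * (2 + |⟨f, xᵢ⟩|) ^ 2`. With `w = β * √(k / (8 * log (4 /
δ)))` this gives margin at least `2 * β`. Thus the empirical smoothed loss is at most empirical
error plus projection term plus `q` (`smoothedLoss_le_add`).

`pacBayes_tiltedGaussian` compares population and empirical smoothed losses for all centres at once,
at cost `‖w • f‖ ^ 2 / 2`, and `complexity_le` fits this cost and both copies of `q` into `T`. A
union bound over `k` with weights `δ / 2 ^ (k + 1)` covers the random number of returned hypotheses,
however it depends on the sample. -/

/-- The standard Gaussian measure, written as an exponential tilt of the volume. -/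
noncomputable def tiltedGaussian (V : Type*) [NormedAddCommGroup V] [InnerProductSpace ℝ V]
    [FiniteDimensional ℝ V] [MeasurableSpace V] [BorelSpace V] : Measure V :=
  (volume : Measure V).tilted fun g => -(1 / 2) * ‖g‖ ^ 2

/-! ### Gaussian shifts, moments and tails. -/

section Gaussian

variable {V : Type*} [NormedAddCommGroup V] [InnerProductSpace ℝ V] [FiniteDimensional ℝ V]
  [MeasurableSpace V] [BorelSpace V]

instance isProbabilityMeasure_tiltedGaussian : IsProbabilityMeasure (tiltedGaussian V) := by
  refine isProbabilityMeasure_tilted ?_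
  -- The Bochner integral of a non-integrable function is 0, so a nonzero value proves
  -- integrability.
  refine Integrable.of_integral_ne_zero ?_
  rw [GaussianFourier.integral_rexp_neg_mul_sq_norm (by norm_num : (0 : ℝ) < 1 / 2)]
  positivity

/-- The Cameron–Martin formula. -/
theorem integral_tiltedGaussian_shift (v : V) (H : V → ℝ) :
    ∫ g, H g ∂(tiltedGaussian V) =
      ∫ g, Real.exp (-inner ℝ v g - ‖v‖ ^ 2 / 2) * H (g + v) ∂(tiltedGaussian V) := by
  unfold tiltedGaussian
  rw [integral_tilted, integral_tilted, ← integral_add_right_eq_self _ v]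
  refine integral_congr_ae (Filter.Eventually.of_forall fun g => ?_)
  have h : -(1 / 2) * ‖g + v‖ ^ 2 = -(1 / 2) * ‖g‖ ^ 2 + (-inner ℝ v g - ‖v‖ ^ 2 / 2) := by
    rw [norm_add_sq_real, real_inner_comm]
    ring
  simp only [smul_eq_mul, h, Real.exp_add]
  ring

/-- Cameron–Martin for the constant 1 and the shift `-v`: the total mass is 1 on both sides. -/
theorem integral_exp_inner_tiltedGaussian (v : V) :
    ∫ g, Real.exp (inner ℝ v g) ∂(tiltedGaussian V) = Real.exp (‖v‖ ^ 2 / 2) := by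
  have h := integral_tiltedGaussian_shift (-v) (fun _ => (1 : ℝ))
  simp only [inner_neg_left, neg_neg, norm_neg, mul_one, sub_eq_add_neg, Real.exp_add,
    integral_mul_const, integral_const, probReal_univ, smul_eq_mul] at h
  rw [Real.exp_neg, ← div_eq_mul_inv, eq_div_iff (Real.exp_pos _).ne'] at h
  linarith

theorem hasSubgaussianMGF_inner_tiltedGaussian (v : V) :
    HasSubgaussianMGF (fun g => inner ℝ v g) (‖v‖₊ ^ 2) (tiltedGaussian V) where
  integrable_exp_mul t := by
    refine Integrable.of_integral_ne_zero ?_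
    simp_rw [← real_inner_smul_left]
    rw [integral_exp_inner_tiltedGaussian]
    exact (Real.exp_pos _).ne'
  mgf_le t := by
    unfold mgf
    simp_rw [← real_inner_smul_left]
    rw [integral_exp_inner_tiltedGaussian, norm_smul, mul_pow]
    simp [mul_comm]

theorem integral_inner_tiltedGaussian (v : V) :
    ∫ g, inner ℝ v g ∂(tiltedGaussian V) = 0 := by
  have h : ∫ g, inner ℝ v (-g) ∂(tiltedGaussian V) = ∫ g, inner ℝ v g ∂(tiltedGaussian V) := by
    unfold tiltedGaussian
    rw [integral_tilted, integral_tilted, ← integral_neg_eq_self]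
    simp only [norm_neg, neg_neg]
  simp only [inner_neg_right, integral_neg] at h
  linarith

/-- Gaussian change of measure: the Donsker–Varadhan inequality for the shift by `v`. -/
theorem exp_integral_shift_le (v : V) {F : V → ℝ} (hF : Measurable F) {C : ℝ}
    (hC : ∀ g, |F g| ≤ C) :
    Real.exp (∫ g, F (g + v) ∂(tiltedGaussian V) - ‖v‖ ^ 2 / 2) ≤
      ∫ g, Real.exp (F g) ∂(tiltedGaussian V) := by
  have hsub := hasSubgaussianMGF_inner_tiltedGaussian v
  have hFi : Integrable (fun g => F (g + v)) (tiltedGaussian V) :=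
    Integrable.of_bound (hF.comp (measurable_add_const v)).aestronglyMeasurable C (Filter.Eventually.of_forall fun g => hC _)
  have hlin : Integrable (fun g => -inner ℝ v g - ‖v‖ ^ 2 / 2) (tiltedGaussian V) :=
    hsub.integrable.neg.sub (integrable_const _)
  have hexp : Integrable (fun g => Real.exp (-inner ℝ v g - ‖v‖ ^ 2 / 2)) (tiltedGaussian V) := by
    simp_rw [sub_eq_add_neg, Real.exp_add]
    simpa using (hsub.integrable_exp_mul (-1)).mul_const (Real.exp (-(‖v‖ ^ 2 / 2)))
  have hcomp : Integrable (fun g => Real.exp ((-inner ℝ v g - ‖v‖ ^ 2 / 2) + F (g + v)))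
      (tiltedGaussian V) := by
    simp_rw [Real.exp_add]
    refine hexp.mul_bdd (c := Real.exp C)
      (Real.measurable_exp.comp (hF.comp (measurable_add_const v))).aestronglyMeasurable
      (Filter.Eventually.of_forall fun g => ?_)
    rw [Real.norm_eq_abs, Real.abs_exp]
    exact Real.exp_le_exp.2 ((le_abs_self _).trans (hC _))
  have hmean : ∫ g, (-inner ℝ v g - ‖v‖ ^ 2 / 2 + F (g + v)) ∂(tiltedGaussian V) =
      ∫ g, F (g + v) ∂(tiltedGaussian V) - ‖v‖ ^ 2 / 2 := by
    have hneg : Integrable (fun g => -inner ℝ v g) (tiltedGaussian V) := hsub.integrable.neg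
    rw [integral_add hlin hFi, integral_sub hneg (integrable_const _), integral_neg,
      integral_inner_tiltedGaussian, integral_const, probReal_univ, one_smul]
    ring
  -- After the shift, the log-density joins `F` in the exponent and the claim is Jensen's inequality
  -- for `exp`.
  rw [← hmean, integral_tiltedGaussian_shift v fun g => Real.exp (F g)]
  simp_rw [← Real.exp_add]
  exact convexOn_exp.map_integral_le Real.continuous_exp.continuousOn isClosed_univ
    (Filter.Eventually.of_forall fun _ => Set.mem_univ _) (hlin.add hFi) hcomp

theorem tiltedGaussian_real_le_inner {x : V} (hx : ‖x‖ = 1) {β : ℝ} (hβ : 0 ≤ β) :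
    (tiltedGaussian V).real {g | β ≤ inner ℝ x g} ≤ Real.exp (-β ^ 2 / 2) := by
  simpa [hx] using (hasSubgaussianMGF_inner_tiltedGaussian x).measure_ge_le hβ

end Gaussian

/-! ### PAC-Bayes inequality with Gaussian prior. -/

section PACBayes

variable {V : Type*} [NormedAddCommGroup V] [InnerProductSpace ℝ V] [FiniteDimensional ℝ V]
  [MeasurableSpace V] [BorelSpace V] {α : Type*} [MeasurableSpace α]

/-- The gap between the mean and the sample mean of `φ`. -/
noncomputable def generalizationGap {n : ℕ} (D : Measure α) (φ : α → ℝ) (S : Fin n → α) : ℝ :=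
  ∫ z, φ z ∂D - (∑ i, φ (S i)) / n

/-- Hoeffding's exponential moment bound. -/
theorem lintegral_exp_generalizationGap_le {n : ℕ} (hn : 0 < n) (D : Measure α)
    [IsProbabilityMeasure D] {φ : α → ℝ} (hφ : Measurable φ) (h01 : ∀ z, φ z ∈ Set.Icc (0 : ℝ) 1)
    (t : ℝ) :
    ∫⁻ S, ENNReal.ofReal (Real.exp (t * generalizationGap D φ S))
      ∂(Measure.pi fun _ : Fin n => D) ≤ ENNReal.ofReal (Real.exp (t ^ 2 / (8 * n))) := by
  have hn' : (n : ℝ) ≠ 0 := by positivity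
  have hsub : HasSubgaussianMGF (fun z => φ z - ∫ z, φ z ∂D) ((‖(1 : ℝ) - 0‖₊ / 2) ^ 2) D :=
    hasSubgaussianMGF_of_mem_Icc hφ.aemeasurable (Filter.Eventually.of_forall h01)
  have hind : iIndepFun (fun (i : Fin n) (S : Fin n → α) => φ (S i) - ∫ z, φ z ∂D)
      (Measure.pi fun _ : Fin n => D) :=
    iIndepFun_pi (X := fun _ z => φ z - ∫ z, φ z ∂D) fun i => by fun_prop
  have hS := HasSubgaussianMGF.sum_of_iIndepFun hind (s := Finset.univ)
    (c := fun _ => (‖(1 : ℝ) - 0‖₊ / 2) ^ 2) fun i _ => by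
      refine HasSubgaussianMGF.of_map (Y := fun S : Fin n → α => S i)
        (X := fun z => φ z - ∫ z, φ z ∂D)
        (measurable_pi_apply i).aemeasurable ?_
      rwa [(measurePreserving_eval (fun _ : Fin n => D) i).map_eq]
  have key : ∀ S : Fin n → α, t * generalizationGap D φ S =
      (-t / n) * ∑ i, (φ (S i) - ∫ z, φ z ∂D) := by
    intro S
    simp only [generalizationGap, Finset.sum_sub_distrib, Finset.sum_const, Finset.card_univ,
      Fintype.card_fin, nsmul_eq_mul]
    field_simp
    ring
  simp_rw [key]
  rw [← ofReal_integral_eq_lintegral_ofReal (hS.integrable_exp_mul _)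
    (Filter.Eventually.of_forall fun _ => (Real.exp_pos _).le)]
  refine ENNReal.ofReal_le_ofReal ((hS.mgf_le _).trans (Real.exp_le_exp.2 (le_of_eq ?_)))
  simp
  field_simp
  ring

theorem measurable_integral_shift {l : V → α → ℝ} (hl : Measurable (Function.uncurry l)) (v : V) :
    Measurable fun z => ∫ g, l (g + v) z ∂(tiltedGaussian V) := by
  have h : Measurable fun q : α × V => l (q.2 + v) q.1 :=
    hl.comp ((measurable_snd.add_const v).prodMk measurable_fst)
  exact (h.stronglyMeasurable.integral_prod_right' (ν := tiltedGaussian V)).measurable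

/-- The PAC-Bayes bound with a Gaussian prior, for all shifted Gaussian posteriors. -/
theorem pacBayes_tiltedGaussian {n : ℕ} (hn : 0 < n) (D : Measure α) [IsProbabilityMeasure D]
    {l : V → α → ℝ} (hl : Measurable (Function.uncurry l))
    (h01 : ∀ g z, l g z ∈ Set.Icc (0 : ℝ) 1) (t : ℝ) {η : ℝ} (hη : 0 < η) :
    (Measure.pi fun _ : Fin n => D) {S | ∃ v : V,
      ‖v‖ ^ 2 / 2 + t ^ 2 / (8 * n) + Real.log (1 / η) <
        t * generalizationGap D (fun z => ∫ g, l (g + v) z ∂(tiltedGaussian V)) S} ≤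
      ENNReal.ofReal η := by
  have hn' : (n : ℝ) ≠ 0 := by positivity
  set γ := tiltedGaussian V
  have hlg : ∀ g, Measurable (l g) := fun g => hl.of_uncurry_left
  have hlz : ∀ z, Measurable (fun g => l g z) := fun z => hl.of_uncurry_right
  have hmean : Measurable fun g => ∫ z, l g z ∂D :=
    (hl.stronglyMeasurable.integral_prod_right (ν := D)).measurable
  have hgap : Measurable fun q : (Fin n → α) × V => generalizationGap D (l q.2) q.1 := by
    unfold generalizationGap
    refine (hmean.comp measurable_snd).sub (Measurable.div_const
      (Finset.measurable_sum _ fun i _ => ?_) _)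
    exact hl.comp (measurable_snd.prodMk ((measurable_pi_apply i).comp measurable_fst))
  have hI01 : ∀ g, ∫ z, l g z ∂D ∈ Set.Icc (0 : ℝ) 1 := fun g =>
    ⟨integral_nonneg fun z => (h01 g z).1, by
      simpa using integral_mono (μ := D) (Integrable.of_mem_Icc 0 1 (hlg g).aemeasurable
        (Filter.Eventually.of_forall (h01 g))) (integrable_const (1 : ℝ)) fun z => (h01 g z).2⟩
  have hgap1 : ∀ g (S : Fin n → α), |generalizationGap D (l g) S| ≤ 1 := by
    intro g S
    have h0 : 0 ≤ (∑ i, l g (S i)) / n :=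
      div_nonneg (Finset.sum_nonneg fun i _ => (h01 g (S i)).1) (by positivity)
    have h1 : (∑ i, l g (S i)) / n ≤ 1 := by
      rw [div_le_one (by positivity)]
      simpa using Finset.sum_le_sum fun i (_ : i ∈ Finset.univ) => (h01 g (S i)).2
    have := hI01 g
    rw [generalizationGap, abs_le]
    constructor <;> linarith [this.1, this.2]
  have hint : ∀ (v : V) z, Integrable (fun g => l (g + v) z) γ := fun v z =>
    Integrable.of_mem_Icc 0 1 ((hlz z).comp (measurable_add_const v)).aemeasurable
      (Filter.Eventually.of_forall fun g => h01 _ z)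
  have hswap : ∀ (v : V) (S : Fin n → α), generalizationGap D (fun z => ∫ g, l (g + v) z ∂γ) S =
      ∫ g, generalizationGap D (l (g + v)) S ∂γ := by
    intro v S
    unfold generalizationGap
    have hprod : Integrable (Function.uncurry fun z g => l (g + v) z) (D.prod γ) := by
      refine Integrable.of_mem_Icc 0 1 (Measurable.aemeasurable ?_)
        (Filter.Eventually.of_forall fun q => h01 _ _)
      exact hl.comp ((measurable_snd.add_const v).prodMk measurable_fst)
    rw [integral_sub, integral_integral_swap hprod, integral_div, integral_finsetSum]
    · exact fun i _ => hint v _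
    · exact Integrable.of_mem_Icc 0 1 (hmean.comp (measurable_add_const v)).aemeasurable
        (Filter.Eventually.of_forall fun g => hI01 _)
    · exact (integrable_finsetSum _ fun i _ => hint v _).div_const _
  have hexpm : Measurable fun q : (Fin n → α) × V =>
      ENNReal.ofReal (Real.exp (t * generalizationGap D (l q.2) q.1)) :=
    (Real.measurable_exp.comp (hgap.const_mul t)).ennreal_ofReal
  -- `W` averages over the prior only. As it does not involve `v`, a single use of Markov's
  -- inequality serves every posterior.
  set W : (Fin n → α) → ENNReal := fun S =>
    ∫⁻ g, ENNReal.ofReal (Real.exp (t * generalizationGap D (l g) S)) ∂γ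
  have hW : Measurable W := hexpm.lintegral_prod_right'
  have hWint : ∫⁻ S, W S ∂(Measure.pi fun _ : Fin n => D) ≤
      ENNReal.ofReal (Real.exp (t ^ 2 / (8 * n))) := by
    rw [lintegral_lintegral_swap hexpm.aemeasurable]
    refine (lintegral_mono fun g =>
      lintegral_exp_generalizationGap_le hn D (hlg g) (h01 g) t).trans ?_
    simp
  set a : ℝ := Real.exp (t ^ 2 / (8 * n)) / η
  have ha : 0 < a := by positivity
  calc _ ≤ (Measure.pi fun _ : Fin n => D) {S | ENNReal.ofReal a ≤ W S} := by
        refine measure_mono ?_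
        rintro S ⟨v, hv⟩
        rw [hswap] at hv
        have hF : Measurable fun g => t * generalizationGap D (l g) S :=
          (hgap.comp (measurable_const.prodMk measurable_id)).const_mul t
        have hb : ∀ g, |t * generalizationGap D (l g) S| ≤ |t| := fun g => by
          rw [abs_mul]
          exact mul_le_of_le_one_right (abs_nonneg _) (hgap1 g S)
        have h := exp_integral_shift_le v hF hb
        rw [integral_const_mul] at h
        have hi : Integrable (fun g => Real.exp (t * generalizationGap D (l g) S)) γ :=
          Integrable.of_bound (C := Real.exp |t|) (Real.measurable_exp.comp hF).aestronglyMeasurable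
            (Filter.Eventually.of_forall fun g => by
              rw [Real.norm_eq_abs, Real.abs_exp]
              exact Real.exp_le_exp.2 ((le_abs_self _).trans (hb g)))
        change ENNReal.ofReal a ≤ W S
        simp only [W]
        rw [← ofReal_integral_eq_lintegral_ofReal hi
          (Filter.Eventually.of_forall fun _ => (Real.exp_pos _).le)]
        refine ENNReal.ofReal_le_ofReal (le_trans ?_ h)
        have : a = Real.exp (t ^ 2 / (8 * n) + Real.log (1 / η)) := by
          rw [Real.exp_add, Real.exp_log (by positivity)]
          simp [a, div_eq_mul_inv]
        rw [this]
        exact Real.exp_le_exp.2 (by linarith)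
    _ ≤ (∫⁻ S, W S ∂(Measure.pi fun _ : Fin n => D)) / ENNReal.ofReal a :=
        meas_ge_le_lintegral_div hW.aemeasurable (by simpa using ha) ENNReal.ofReal_ne_top
    _ ≤ ENNReal.ofReal (Real.exp (t ^ 2 / (8 * n))) / ENNReal.ofReal a := by gcongr
    _ = ENNReal.ofReal η := by
        rw [← ENNReal.ofReal_div_of_pos ha]
        congr 1
        simp only [a]
        field_simp

end PACBayes

/-! ### Smoothed margin loss against classification error. -/

section Margin

variable {p : ℕ}

/-- The zero-one loss of the linear classifier `g` at margin `β`. -/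
noncomputable def marginLoss (β : ℝ) (g : EuclideanSpace ℝ (Fin p)) (z : Individual p) : ℝ :=
  {z : Individual p | z.2.2 * inner ℝ g z.1 < β}.indicator (fun _ => 1) z

theorem measurable_uncurry_marginLoss (β : ℝ) :
    Measurable (Function.uncurry (marginLoss (p := p) β)) := by
  have hs : MeasurableSet {q : EuclideanSpace ℝ (Fin p) × Individual p |
      q.2.2.2 * inner ℝ q.1 q.2.1 < β} :=
    measurableSet_lt (by fun_prop) measurable_const
  exact (measurable_const (a := (1 : ℝ))).indicator hs

theorem marginLoss_mem_Icc (β : ℝ) (g : EuclideanSpace ℝ (Fin p)) (z : Individual p) :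
    marginLoss β g z ∈ Set.Icc (0 : ℝ) 1 := by
  unfold marginLoss Set.indicator
  split_ifs <;> simp

/-- The margin loss averaged over the Gaussian measure centred at `v`. -/
noncomputable def smoothedLoss (β : ℝ) (v : EuclideanSpace ℝ (Fin p)) (z : Individual p) : ℝ :=
  ∫ g, marginLoss β (g + v) z ∂(tiltedGaussian (EuclideanSpace ℝ (Fin p)))

theorem smoothedLoss_eq (β : ℝ) (v : EuclideanSpace ℝ (Fin p)) (z : Individual p) :
    smoothedLoss β v z = (tiltedGaussian (EuclideanSpace ℝ (Fin p))).real
      {g | inner ℝ (z.2.2 • z.1) g + z.2.2 * inner ℝ v z.1 < β} := by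
  have hs : MeasurableSet {g : EuclideanSpace ℝ (Fin p) |
      inner ℝ (z.2.2 • z.1) g + z.2.2 * inner ℝ v z.1 < β} :=
    measurableSet_lt (by fun_prop) measurable_const
  rw [← integral_indicator_one hs]
  refine integral_congr_ae (Filter.Eventually.of_forall fun g => ?_)
  simp only [marginLoss, Set.indicator, Set.mem_ofPred_eq, inner_add_left, real_inner_smul_left,
    real_inner_comm z.1 g, mul_add, Pi.one_apply]

theorem smoothedLoss_nonneg (β : ℝ) (v : EuclideanSpace ℝ (Fin p)) (z : Individual p) :
    0 ≤ smoothedLoss β v z := by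
  rw [smoothedLoss_eq]
  exact measureReal_nonneg

theorem smoothedLoss_le_one (β : ℝ) (v : EuclideanSpace ℝ (Fin p)) (z : Individual p) :
    smoothedLoss β v z ≤ 1 := by
  rw [smoothedLoss_eq]
  exact measureReal_le_one

theorem measurable_smoothedLoss (β : ℝ) (v : EuclideanSpace ℝ (Fin p)) :
    Measurable (smoothedLoss β v) := by
  exact measurable_integral_shift (measurable_uncurry_marginLoss β) v

theorem norm_label_smul {z : Individual p} (hx : ‖z.1‖ = 1) (hy : z.2.2 = 1 ∨ z.2.2 = -1) :
    ‖z.2.2 • z.1‖ = 1 := by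
  rcases hy with h | h <;> simp [h, hx]

/-- With a nonpositive score at the centre, the margin reaches `β` only if the noise contributes at
least `β`. -/
theorem le_smoothedLoss {β : ℝ} (hβ : 0 ≤ β) {v : EuclideanSpace ℝ (Fin p)} {z : Individual p}
    (hx : ‖z.1‖ = 1) (hy : z.2.2 = 1 ∨ z.2.2 = -1) (hv : z.2.2 * inner ℝ v z.1 ≤ 0) :
    1 - Real.exp (-β ^ 2 / 2) ≤ smoothedLoss β v z := by
  set γ := tiltedGaussian (EuclideanSpace ℝ (Fin p))
  have h := tiltedGaussian_real_le_inner (norm_label_smul hx hy) hβ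
  have hs : MeasurableSet {g : EuclideanSpace ℝ (Fin p) | β ≤ inner ℝ (z.2.2 • z.1) g} :=
    measurableSet_le measurable_const (by fun_prop)
  have hc := probReal_compl_eq_one_sub (μ := γ) hs
  rw [smoothedLoss_eq]
  calc _ ≤ γ.real {g | β ≤ inner ℝ (z.2.2 • z.1) g}ᶜ := by rw [hc]; linarith
    _ ≤ _ := measureReal_mono fun g hg => by
      simp only [Set.mem_compl_iff, Set.mem_ofPred_eq, not_le] at hg ⊢
      linarith

/-- From `2 * β`, the noise has to remove more than `β` to bring the margin below `β`. -/
theorem smoothedLoss_le {β : ℝ} (hβ : 0 ≤ β) {v : EuclideanSpace ℝ (Fin p)} {z : Individual p}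
    (hx : ‖z.1‖ = 1) (hy : z.2.2 = 1 ∨ z.2.2 = -1) (hv : 2 * β ≤ z.2.2 * inner ℝ v z.1) :
    smoothedLoss β v z ≤ Real.exp (-β ^ 2 / 2) := by
  have hn : ‖-(z.2.2 • z.1)‖ = 1 := by rw [norm_neg, norm_label_smul hx hy]
  rw [smoothedLoss_eq]
  refine (measureReal_mono fun g hg => ?_).trans (tiltedGaussian_real_le_inner hn hβ)
  simp only [Set.mem_ofPred_eq, inner_neg_left] at hg ⊢
  linarith

theorem label_mul_inner_nonpos_of_mem {f : EuclideanSpace ℝ (Fin p)} {z : Individual p}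
    (hy : z.2.2 = 1 ∨ z.2.2 = -1) (hz : z ∈ misclassified f) : z.2.2 * inner ℝ f z.1 ≤ 0 := by
  have hz' : Real.sign (inner ℝ f z.1) ≠ z.2.2 := hz
  by_contra! hpos
  apply hz'
  rcases hy with h | h <;> rw [h] at hpos ⊢
  · exact Real.sign_of_pos (by linarith)
  · exact Real.sign_of_neg (by linarith)

theorem label_mul_inner_eq_abs_of_notMem {f : EuclideanSpace ℝ (Fin p)} {z : Individual p}
    (hz : z ∉ misclassified f) : z.2.2 * inner ℝ f z.1 = |inner ℝ f z.1| := by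
  have hz' : Real.sign (inner ℝ f z.1) = z.2.2 := not_not.1 hz
  rw [← hz']
  rcases lt_trichotomy (inner ℝ f z.1) 0 with h | h | h
  · rw [Real.sign_of_neg h, abs_of_neg h, neg_one_mul]
  -- Since `Real.sign 0 = 0`, correct classification forces label 0 here, and both sides vanish.
  · simp [h]
  · rw [Real.sign_of_pos h, abs_of_pos h, one_mul]

theorem measurableSet_misclassified (f : EuclideanSpace ℝ (Fin p)) :
    MeasurableSet (misclassified f) := by
  have h : Measurable Real.sign := by
    unfold Real.sign
    exact Measurable.ite measurableSet_Iio measurable_const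
      (Measurable.ite measurableSet_Ioi measurable_const measurable_const)
  exact (measurableSet_eq_fun (by fun_prop) (by fun_prop)).compl

theorem expectedError_le_integral_smoothedLoss (D : Measure (Individual p))
    [IsProbabilityMeasure D] (hx : ∀ᵐ z ∂D, ‖z.1‖ = 1) (hy : ∀ᵐ z ∂D, z.2.2 = 1 ∨ z.2.2 = -1)
    (f : EuclideanSpace ℝ (Fin p)) {w β : ℝ} (hw : 0 ≤ w) (hβ : 0 ≤ β) :
    expectedError D f ≤ ∫ z, smoothedLoss β (w • f) z ∂D + Real.exp (-β ^ 2 / 2) := by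
  have hi : Integrable (smoothedLoss β (w • f)) D :=
    Integrable.of_mem_Icc 0 1 (measurable_smoothedLoss β _).aemeasurable
      (Filter.Eventually.of_forall fun z => ⟨smoothedLoss_nonneg _ _ z, smoothedLoss_le_one _ _ z⟩)
  have hm := measurableSet_misclassified f
  have h1 : ∫ z, smoothedLoss β (w • f) z ∂D + Real.exp (-β ^ 2 / 2) =
      ∫ z, (smoothedLoss β (w • f) z + Real.exp (-β ^ 2 / 2)) ∂D := by
    rw [integral_add hi (integrable_const _)]
    simp
  rw [h1, expectedError, ← integral_indicator_one hm]
  refine integral_mono_ae ((integrable_const (1 : ℝ)).indicator hm)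
    (hi.add (integrable_const _)) ?_
  filter_upwards [hx, hy] with z hzx hzy
  by_cases hz : z ∈ misclassified f
  · have hneg : z.2.2 * inner ℝ (w • f) z.1 ≤ 0 := by
      rw [real_inner_smul_left, mul_left_comm]
      exact mul_nonpos_of_nonneg_of_nonpos hw (label_mul_inner_nonpos_of_mem hzy hz)
    simp only [Set.indicator_of_mem hz, Pi.one_apply]
    linarith [le_smoothedLoss hβ hzx hzy hneg]
  · rw [Set.indicator_of_notMem hz]
    exact add_nonneg (smoothedLoss_nonneg _ _ z) (Real.exp_pos _).le

/-- The level lies in `[0, 1]`, so the first exponential has a nonnegative exponent. -/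
theorem one_le_distortionFactor (k : ℕ) (hstar f x : EuclideanSpace ℝ (Fin p)) :
    1 ≤ distortionFactor k hstar (distortionLevel f x) x := by
  have hc0 : 0 ≤ distortionLevel f x := by unfold distortionLevel; positivity
  have hc1 : distortionLevel f x ≤ 1 := by
    unfold distortionLevel
    rw [div_le_one (by positivity)]
    linarith
  have h1 : 1 ≤ Real.exp (distortionLevel f x * k * (inner ℝ hstar x) ^ 2 /
      (4 - 2 * distortionLevel f x)) :=
    Real.one_le_exp (div_nonneg (by positivity) (by linarith))
  unfold distortionFactor
  linarith [Real.exp_pos (-(distortionLevel f x * k * (inner ℝ hstar x) ^ 2 /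
    (2 + 2 * distortionLevel f x)))]

/-- Either the projection term of a correctly classified point is at least one, or its margin is
large. -/
theorem smoothedLoss_le_add (k : ℕ) {δ : ℝ} (hδ : 0 < δ) (hδ4 : δ < 4)
    (hstar f : EuclideanSpace ℝ (Fin p)) {z : Individual p} (hx : ‖z.1‖ = 1)
    (hy : z.2.2 = 1 ∨ z.2.2 = -1) {β : ℝ} (hβ : 0 ≤ β) :
    smoothedLoss β ((β * Real.sqrt (k / (8 * Real.log (4 / δ)))) • f) z ≤
      (misclassified f).indicator (fun _ => (1 : ℝ)) z +
      4 / δ * (distortionFactor k hstar (distortionLevel f z.1) z.1 *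
        Real.exp (-(k * (inner ℝ f z.1) ^ 2 / (8 * (2 + |inner ℝ f z.1|) ^ 2)))) +
      Real.exp (-β ^ 2 / 2) := by
  have hL : 0 < Real.log (4 / δ) := Real.log_pos (by rw [lt_div_iff₀ hδ]; linarith)
  have hg := one_le_distortionFactor k hstar f z.1
  have h1 := smoothedLoss_le_one β ((β * Real.sqrt (k / (8 * Real.log (4 / δ)))) • f) z
  have hq := Real.exp_pos (-β ^ 2 / 2)
  set τ := |inner ℝ f z.1| with hτ
  have hτ0 : 0 ≤ τ := abs_nonneg _
  have hsq : (inner ℝ f z.1) ^ 2 = τ ^ 2 := (sq_abs _).symm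
  rw [hsq]
  have hterm : 0 ≤ 4 / δ * (distortionFactor k hstar (distortionLevel f z.1) z.1 *
      Real.exp (-(k * τ ^ 2 / (8 * (2 + τ) ^ 2)))) := by positivity
  by_cases hz : z ∈ misclassified f
  · rw [Set.indicator_of_mem hz]
    linarith
  rw [Set.indicator_of_notMem hz]
  by_cases hm : k * τ ^ 2 / (8 * (2 + τ) ^ 2) ≤ Real.log (4 / δ)
  · have he : δ / 4 ≤ Real.exp (-(k * τ ^ 2 / (8 * (2 + τ) ^ 2))) := by
      rw [← Real.exp_log (show 0 < δ / 4 by positivity), Real.exp_le_exp,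
        show δ / 4 = (4 / δ)⁻¹ by rw [inv_div], Real.log_inv]
      linarith
    have : 1 ≤ 4 / δ * (distortionFactor k hstar (distortionLevel f z.1) z.1 *
        Real.exp (-(k * τ ^ 2 / (8 * (2 + τ) ^ 2)))) := by
      calc (1 : ℝ) = 4 / δ * (1 * (δ / 4)) := by field_simp
        _ ≤ _ := by gcongr
    linarith
  · push Not at hm
    rw [lt_div_iff₀ (by positivity)] at hm
    -- Only `(2 + τ) ^ 2 ≥ 4` is kept from the denominator of the exponent.
    have hb : 2 ^ 2 ≤ k / (8 * Real.log (4 / δ)) * τ ^ 2 := by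
      rw [div_mul_eq_mul_div, le_div_iff₀ (by positivity)]
      nlinarith [mul_nonneg hL.le hτ0, mul_nonneg hL.le (sq_nonneg τ)]
    have hb2 : 2 ≤ Real.sqrt (k / (8 * Real.log (4 / δ))) * τ := by
      rw [← Real.sqrt_sq hτ0, ← Real.sqrt_mul (by positivity)]
      exact Real.le_sqrt_of_sq_le hb
    have := smoothedLoss_le hβ hx hy
      (v := (β * Real.sqrt (k / (8 * Real.log (4 / δ)))) • f) (by
        rw [real_inner_smul_left, mul_left_comm, label_mul_inner_eq_abs_of_notMem hz, ← hτ]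
        nlinarith)
    linarith

end Margin

/-! ### Choice of parameters and the final union bound. -/

section Main

/-- The margin at which the smoothed loss is taken. -/
noncomputable def marginLevel (n k : ℕ) : ℝ :=
  Real.sqrt (2 * Real.log (Real.exp 1 * n / (k + 1)))

/-- The norm of the centre of the Gaussian posterior. -/
noncomputable def posteriorScale (n k : ℕ) (δ : ℝ) : ℝ :=
  marginLevel n k * Real.sqrt (k / (8 * Real.log (4 / δ)))

theorem one_le_log_exp_one_mul_div {n k : ℕ} (hk : k + 1 ≤ n) :
    1 ≤ Real.log (Real.exp 1 * n / (k + 1)) := by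
  have hkn : (k : ℝ) + 1 ≤ n := by exact_mod_cast hk
  have hn : (0 : ℝ) < n := by exact_mod_cast (Nat.succ_pos k).trans_le hk
  rw [Real.le_log_iff_exp_le (by positivity), le_div_iff₀ (by positivity)]
  gcongr

/-- The margin level is tuned so that this tail is a small multiple of `(k + 1) / n`, which is
dominated by `T`. -/
theorem exp_neg_marginLevel_sq {n k : ℕ} (hk : k + 1 ≤ n) :
    Real.exp (-marginLevel n k ^ 2 / 2) = (k + 1) / (Real.exp 1 * n) := by
  have h1 := one_le_log_exp_one_mul_div hk
  have hn : (0 : ℝ) < n := by exact_mod_cast (Nat.succ_pos k).trans_le hk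
  rw [marginLevel, Real.sq_sqrt (by linarith),
    show -(2 * Real.log (Real.exp 1 * n / (k + 1))) / 2 =
      -Real.log (Real.exp 1 * n / (k + 1)) by ring,
    Real.exp_neg, Real.exp_log (by positivity), inv_div]

theorem vcTerm_pos {n k : ℕ} (hk : k + 1 ≤ n) {δ : ℝ} (hδ : 0 < δ) (hδ1 : δ < 1) :
    0 < vcTerm n k δ := by
  have h1 := one_le_log_exp_one_mul_div hk
  have hn : (0 : ℝ) < n := by exact_mod_cast (Nat.succ_pos k).trans_le hk
  have hL : 0 < Real.log (1 / δ) := Real.log_pos (by rw [lt_div_iff₀ hδ]; linarith)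
  unfold vcTerm
  have : 0 < Real.log (Real.exp 1 * n / (k + 1)) := by linarith
  positivity

/-- The PAC-Bayes parameter is `t = n * T`, and `q` is paid twice, for the population and for the
sample. With `T = 2 * r`, the right side is at least `2.4 * n * r ^ 2`, while the left side is at
most `1.5 * n * r ^ 2`. -/
theorem complexity_le {n k : ℕ} (hk : k + 1 ≤ n) {δ : ℝ} (hδ : 0 < δ) (hδ4 : δ < 1 / 4) :
    posteriorScale n k δ ^ 2 / 2 + (n * vcTerm n k δ) ^ 2 / (8 * n) +
        Real.log (1 / (δ / 2 ^ (k + 1))) ≤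
      n * vcTerm n k δ * (vcTerm n k δ - 2 * Real.exp (-marginLevel n k ^ 2 / 2)) := by
  have hn : (0 : ℝ) < n := by exact_mod_cast (Nat.succ_pos k).trans_le hk
  have hkn : (k : ℝ) + 1 ≤ n := by exact_mod_cast hk
  have hℓ := one_le_log_exp_one_mul_div hk
  have hL : 0 < Real.log (1 / δ) := Real.log_pos (by rw [lt_div_iff₀ hδ]; linarith)
  -- From `δ < 1 / 4` and `log 16 = 4 * log 2`; then `8 * 2.77 > 20` gives the factor `0.05` in
  -- `hKL`.
  have hL4 : 2.77 ≤ Real.log (4 / δ) := by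
    have h16 : Real.log 16 ≤ Real.log (4 / δ) :=
      Real.log_le_log (by norm_num) (by rw [le_div_iff₀ hδ]; linarith)
    have : Real.log 16 = 4 * Real.log 2 := by
      rw [show (16 : ℝ) = 2 ^ 4 by norm_num, Real.log_pow]
      norm_num
    linarith [Real.log_two_gt_d9]
  have hη : Real.log (1 / (δ / 2 ^ (k + 1))) = Real.log (1 / δ) + (k + 1) * Real.log 2 := by
    rw [one_div_div, ← mul_one_div, mul_comm, Real.log_mul (by positivity) (by positivity),
      Real.log_pow]
    push_cast
    ring
  rw [exp_neg_marginLevel_sq hk, hη]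
  have hps : posteriorScale n k δ ^ 2 =
      2 * Real.log (Real.exp 1 * n / (k + 1)) * (k / (8 * Real.log (4 / δ))) := by
    unfold posteriorScale marginLevel
    rw [mul_pow, Real.sq_sqrt (by linarith), Real.sq_sqrt (by positivity)]
  rw [hps]
  set ℓ := Real.log (Real.exp 1 * n / (k + 1))
  set r := Real.sqrt (((k + 1) * ℓ + Real.log (1 / δ)) / n) with hr
  have hV : vcTerm n k δ = 2 * r := rfl
  have hr2 : n * r ^ 2 = (k + 1) * ℓ + Real.log (1 / δ) := by
    rw [hr, Real.sq_sqrt (by positivity)]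
    field_simp
  have hr0 : 0 ≤ r := Real.sqrt_nonneg _
  have hkr : ((k : ℝ) + 1) / n ≤ r := by
    apply Real.le_sqrt_of_sq_le
    rw [div_pow, div_le_div_iff₀ (by positivity) hn]
    have : ((k : ℝ) + 1) ^ 2 ≤ n * ((k + 1) * ℓ + Real.log (1 / δ)) := by
      calc ((k : ℝ) + 1) ^ 2 ≤ n * (k + 1) := by nlinarith
        _ ≤ n * ((k + 1) * ℓ + Real.log (1 / δ)) :=
          mul_le_mul_of_nonneg_left (by nlinarith) hn.le
    nlinarith
  -- Here `1 / e < 0.4`.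
  have hq : ((k : ℝ) + 1) / (Real.exp 1 * n) ≤ r * 0.4 := by
    rw [mul_comm (Real.exp 1), ← div_div, div_le_iff₀ (Real.exp_pos 1)]
    nlinarith [Real.exp_one_gt_d9]
  have hKL : 2 * ℓ * (k / (8 * Real.log (4 / δ))) / 2 ≤ ℓ * k * 0.05 := by
    have : (k : ℝ) / (8 * Real.log (4 / δ)) ≤ k * 0.05 := by
      rw [div_le_iff₀ (by positivity)]
      nlinarith [Nat.cast_nonneg (α := ℝ) k]
    nlinarith
  have hlog2 : ((k : ℝ) + 1) * Real.log 2 ≤ (k + 1) * ℓ * 0.7 := by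
    have := Real.log_two_lt_d9
    rw [mul_assoc]
    gcongr
    linarith
  have ht : (n * (2 * r)) ^ 2 / (8 * n) = n * r ^ 2 / 2 := by
    field_simp
    ring
  rw [hV, ht]
  have hfin : n * r * ((k + 1) / (Real.exp 1 * n)) ≤ n * r * (r * 0.4) := by gcongr
  nlinarith

variable {p : ℕ}

/-- A generalization gap bound for the smoothed loss gives the error bound. -/
theorem expectedError_le_of_gap_le {n k : ℕ} (hk : k + 1 ≤ n) (D : Measure (Individual p))
    [IsProbabilityMeasure D] (hx : ∀ᵐ z ∂D, ‖z.1‖ = 1) (hy : ∀ᵐ z ∂D, z.2.2 = 1 ∨ z.2.2 = -1)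
    {δ : ℝ} (hδ : 0 < δ) (hδ4 : δ < 1 / 4) (hstar f : EuclideanSpace ℝ (Fin p)) (hf : ‖f‖ = 1)
    {S : Fin n → Individual p} (hSx : ∀ i, ‖(S i).1‖ = 1)
    (hSy : ∀ i, (S i).2.2 = 1 ∨ (S i).2.2 = -1)
    (hgap : n * vcTerm n k δ * generalizationGap D
        (smoothedLoss (marginLevel n k) (posteriorScale n k δ • f)) S ≤
      ‖posteriorScale n k δ • f‖ ^ 2 / 2 + (n * vcTerm n k δ) ^ 2 / (8 * n) +
        Real.log (1 / (δ / 2 ^ (k + 1)))) :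
    expectedError D f ≤ empiricalError S f + vcTerm n k δ + projectionTerm k δ hstar S f := by
  have hn : (0 : ℝ) < n := by exact_mod_cast (Nat.succ_pos k).trans_le hk
  have hβ : 0 ≤ marginLevel n k := Real.sqrt_nonneg _
  have hT := vcTerm_pos hk hδ (by linarith)
  rw [norm_smul, hf, mul_one, Real.norm_eq_abs, sq_abs] at hgap
  have hg := le_of_mul_le_mul_left (hgap.trans (complexity_le hk hδ hδ4)) (by positivity)
  have hpop := expectedError_le_integral_smoothedLoss D hx hy f
    (show 0 ≤ posteriorScale n k δ by unfold posteriorScale; positivity) hβ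
  set q := Real.exp (-marginLevel n k ^ 2 / 2)
  have hemp : (∑ i, smoothedLoss (marginLevel n k) (posteriorScale n k δ • f) (S i)) / n ≤
      empiricalError S f + projectionTerm k δ hstar S f + q := by
    have hsum := Finset.sum_le_sum fun i (_ : i ∈ Finset.univ) =>
      smoothedLoss_le_add k hδ (by linarith) hstar f (hSx i) (hSy i) hβ
    rw [Finset.sum_add_distrib, Finset.sum_add_distrib, ← Finset.mul_sum] at hsum
    simp only [Finset.sum_const, Finset.card_univ, Fintype.card_fin, nsmul_eq_mul] at hsum
    refine (div_le_div_of_nonneg_right hsum hn.le).trans (le_of_eq ?_)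
    change (_ + _ + n * q) / n = _
    unfold empiricalError projectionTerm
    field_simp
  unfold generalizationGap at hg
  linarith

end Main

theorem mainTheorem2 {p n m : ℕ} {Ω : Type*} [MeasurableSpace Ω]
    (P : Measure Ω) [IsProbabilityMeasure P]
    (D : Measure (Individual p)) [IsProbabilityMeasure D]
    (hx : ∀ᵐ z ∂D, ‖z.1‖ = 1) (hy : ∀ᵐ z ∂D, z.2.2 = 1 ∨ z.2.2 = -1)
    (hstar : EuclideanSpace ℝ (Fin p))
    (Z : Fin n → Ω → Individual p) (h : Fin m → Ω → EuclideanSpace ℝ (Fin p))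
    (R : Ω → Finset (Fin m)) (hrun : IsSoftThresholdRun P D hstar Z h R)
    (δ : ℝ) (hδ : 0 < δ) :
    ∃ G : Set Ω, MeasurableSet G ∧ 1 - 4 * δ ≤ P.real G ∧
      ∀ ω ∈ G, (R ω).card + 1 ≤ n → ∀ f : EuclideanSpace ℝ (Fin p), ‖f‖ = 1 →
        expectedError D f ≤ empiricalError (fun i => Z i ω) f + vcTerm n (R ω).card δ +
          projectionTerm (R ω).card δ hstar (fun i => Z i ω) f := by
  rcases le_or_gt (1 / 4) δ with hδ4 | hδ4
  -- For `δ ≥ 1 / 4` the required probability is nonpositive.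
  · exact ⟨∅, MeasurableSet.empty, by simp; linarith, by simp⟩
  rcases Nat.eq_zero_or_pos n with hn | hn
  · exact ⟨Set.univ, MeasurableSet.univ, by simp; linarith, fun ω _ hk => by omega⟩
  let B : ℕ → Set (Fin n → Individual p) := fun k => {S | ∃ v : EuclideanSpace ℝ (Fin p),
    ‖v‖ ^ 2 / 2 + (n * vcTerm n k δ) ^ 2 / (8 * n) + Real.log (1 / (δ / 2 ^ (k + 1))) <
      n * vcTerm n k δ * generalizationGap D (smoothedLoss (marginLevel n k) v) S}
  have hB : ∀ k, (Measure.pi fun _ : Fin n => D) (B k) ≤ ENNReal.ofReal (δ / 2 ^ (k + 1)) :=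
    fun k => pacBayes_tiltedGaussian hn D (measurable_uncurry_marginLoss _)
      (marginLoss_mem_Icc _) _ (by positivity)
  -- Each `B k` is an uncountable union over centres, so a measurable hull replaces a measurability
  -- proof.
  set T := toMeasurable (Measure.pi fun _ : Fin n => D) (⋃ k, B k)
  have hT : (Measure.pi fun _ : Fin n => D) T ≤ ENNReal.ofReal δ := by
    have hs : HasSum (fun k : ℕ => δ / 2 ^ (k + 1)) δ := by
      have := hasSum_geometric_two' δ
      simpa only [pow_succ', div_div] using this
    rw [measure_toMeasurable]
    refine (measure_iUnion_le _).trans ((ENNReal.tsum_le_tsum hB).trans (le_of_eq ?_))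
    rw [← ENNReal.ofReal_tsum_of_nonneg (fun k => by positivity) hs.summable, hs.tsum_eq]
  have hZm : ∀ i, AEMeasurable (Z i) P := fun i => (hrun.sample_law i).aemeasurable
  have hmap : P.map (fun ω i => Z i ω) = Measure.pi fun _ : Fin n => D := by
    rw [hrun.sample_indep.map_fun_eq_pi_map hZm]
    congr 1
    funext i
    exact (hrun.sample_law i).map_eq
  have hPT : P ((fun ω i => Z i ω) ⁻¹' T) ≤ ENNReal.ofReal δ := by
    rw [← Measure.map_apply_of_aemeasurable (aemeasurable_pi_lambda _ hZm)
      (measurableSet_toMeasurable _ _), hmap]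
    exact hT
  have hgood : ∀ᵐ ω ∂P, ∀ i, ‖(Z i ω).1‖ = 1 ∧ ((Z i ω).2.2 = 1 ∨ (Z i ω).2.2 = -1) := by
    refine ae_all_iff.2 fun i => ae_of_ae_map
      (p := fun z : Individual p => ‖z.1‖ = 1 ∧ (z.2.2 = 1 ∨ z.2.2 = -1)) (hZm i) ?_
    rw [(hrun.sample_law i).map_eq]
    exact hx.and hy
  set N := {ω | ¬ ∀ i, ‖(Z i ω).1‖ = 1 ∧ ((Z i ω).2.2 = 1 ∨ (Z i ω).2.2 = -1)}
  have hN : P N = 0 := hgood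
  set E := toMeasurable P (N ∪ (fun ω i => Z i ω) ⁻¹' T)
  have hE : P.real E ≤ δ := by
    refine ENNReal.toReal_le_of_le_ofReal hδ.le ?_
    rw [measure_toMeasurable]
    refine (measure_union_le _ _).trans ?_
    rwa [hN, zero_add]
  refine ⟨Eᶜ, (measurableSet_toMeasurable _ _).compl, ?_, fun ω hω hk f hf => ?_⟩
  · rw [probReal_compl_eq_one_sub (measurableSet_toMeasurable _ _)]
    linarith
  · have hω' : ω ∉ N ∪ (fun ω i => Z i ω) ⁻¹' T := fun hmem => hω (subset_toMeasurable _ _ hmem)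
    rw [Set.mem_union, not_or] at hω'
    have hS := not_not.1 hω'.1
    refine expectedError_le_of_gap_le hk D hx hy hδ hδ4 hstar f hf (fun i => (hS i).1)
      (fun i => (hS i).2) ?_
    by_contra! hlt
    exact hω'.2 (subset_toMeasurable _ _ (Set.mem_iUnion.2 ⟨_, _, hlt⟩))
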